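/- \textbf{Setting.} Let $\Omega$ and $S$ be Polish spaces with their Borel $\sigma$-fields, let $r$ be a probability measure on $\Omega$, let $\kappa:\Omega\to\{0,1,\ldots,\infty\}$ be measurable, and for each $\omega\in\Omega$ let $\gamma[\omega]:S^{\kappa(\omega)}\to S$ be a map such that, for every $k\in\{0,1,\ldots,\infty\}$, $(\omega,x)\mapsto\gamma[\omega](x)$ is jointly measurable on $\{\kappa=k\}\times S^k$. Let $d\in\{1,2,\ldots,\infty\}$ be such that $\kappa(\omega)\le d$ for all $\omega$, and let $\mathbb T$ be the set of finite words over an alphabet with $d$ letters $1,2,\ldots$ (all positive integers if $d=\infty$); $\mathbf i\mathbf j$ denotes concatenation and $|\mathbf i|$ the length of $\mathbf i$. Let $\mathcal P(S)$ be the space of probability measures on $S$ with the topology of weak convergence and its Borel $\sigma$-field. For measurable $g:S^k\to S$ let $\check g(\mu_1,\ldots,\mu_k)$ be the image of $\mu_1\otimes\cdots\otimes\mu_k$ under $g$, let $T_g(\mu):=\check g(\mu,\ldots,\mu)$, and put $$T(\mu):=\int_\Omega r(\mathrm d\omega)\,T_{\gamma[\omega]}(\mu)\qquad(\mu\in\mathcal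 P(S)).$$ A \emph{Recursive Tree Process} (RTP) corresponding to the map $\gamma$ and a solution $\mu$ of $T(\mu)=\mu$ is a family of random variables $(\omega_{\mathbf i},X_{\mathbf i})_{\mathbf i\in\mathbb T}$ on a probability space, with values in $\Omega\times S$, such that (i) $(\omega_{\mathbf i})_{\mathbf i\in\mathbb T}$ are i.i.d. with law $r$; (ii) for each $t\ge1$, the $(X_{\mathbf i})_{|\mathbf i|=t}$ are i.i.d. with law $\mu$ and independent of $(\omega_{\mathbf i})_{|\mathbf i|<t}$; (iii) for each $\mathbf i\in\mathbb T$, almost surely $X_{\mathbf i}=\gamma[\omega_{\mathbf i}](X_{\mathbf i1},\ldots,X_{\mathbf i\kappa(\omega_{\mathbf i})})$ (with $X_{\mathbf i}=\gamma[\omega_{\mathbf i}](X_{\mathbf i1},X_{\mathbf i2},\ldots)$ if $\kappa(\omega_{\mathbf i})=\infty$). Let $\check\gamma$ be the map with the same $\kappa$, with $S$ replaced by $\mathcal P(S)$ and with $\check\gamma[\omega]:=\check g$ for $g=\gamma[\omega]$; let $\check T:\mathcal P(\mathcal P(S))\to\mathcal P(\mathcal P(S))$ be the corresponding map, $\check T(\rho)=\int_\Omega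 r(\mathrm d\omega)\,T_{\check\gamma[\omega]}(\rho)$. \textbf{Proposition.} Let $(\omega_{\mathbf i},X_{\mathbf i})_{\mathbf i\in\mathbb T}$ be an RTP corresponding to $\gamma$ and a solution $\mu$ of $T(\mu)=\mu$. (a) The iterates $\check T^t(\delta_\mu)$ converge weakly in $\mathcal P(\mathcal P(S))$ as $t\to\infty$ to a unique limit $\underline\mu$, which solves $\check T(\underline\mu)=\underline\mu$. If for each $\mathbf i\in\mathbb T$ $$\xi_{\mathbf i}:=\mathbb P\big[X_{\mathbf i}\in\cdot\,\big|\,(\omega_{\mathbf i\mathbf j})_{\mathbf j\in\mathbb T}\big]$$ is (any version of) the conditional law of $X_{\mathbf i}$ given the randomness in the subtree rooted at $\mathbf i$, then $(\omega_{\mathbf i},\xi_{\mathbf i})_{\mathbf i\in\mathbb T}$ is an RTP corresponding to the map $\check\gamma$ and the solution $\underline\mu$ of the equation $\check T(\rho)=\rho$. (b) The law $\overline\mu$ of $\delta_X$, where $X$ has law $\mu$, solves $\check T(\overline\mu)=\overline\mu$, and $(\omega_{\mathbf i},\delta_{X_{\mathbf i}})_{\mathbf i\in\mathbb T}$ is an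 RTP corresponding to $\check\gamma$ and $\overline\mu$. -/

import Mathlib

open MeasureTheory ProbabilityTheory Filter Topology

namespace RecTree

/-! The sigma-algebra on `ProbabilityMeasure S` generated by the evaluations is the Borel
sigma-algebra of the topology of weak convergence. -/

section WeakBorel

/-- A countable family of sets of probability measures generating the weak topology. -/
def weakSubbasis (S : Type*) [MeasurableSpace S] [TopologicalSpace S]
    [SecondCountableTopology S] : Set (Set (ProbabilityMeasure S)) :=
  Set.range fun p : {F : Set (Set S) // F.Finite ∧ F ⊆ TopologicalSpace.countableBasis S} × ℚ =>
    {μ : ProbabilityMeasure S | ENNReal.ofReal (p.2 : ℝ) < (μ : Measure S) (⋃₀ p.1.1)}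

variable {S : Type*} [MeasurableSpace S] [TopologicalSpace S]

theorem weakSubbasis_countable [SecondCountableTopology S] : (weakSubbasis S).Countable := by
  have : Countable {F : Set (Set S) // F.Finite ∧ F ⊆ TopologicalSpace.countableBasis S} :=
    (Set.countable_ofPred_finite_subset (TopologicalSpace.countable_countableBasis S)).to_subtype
  exact Set.countable_range _

theorem isOpen_setOf_lt_measure [HasOuterApproxClosed S] [OpensMeasurableSpace S]
    {U : Set S} (hU : IsOpen U) (c : ENNReal) :
    IsOpen {μ : ProbabilityMeasure S | c < (μ : Measure S) U} := by
  rw [isOpen_iff_mem_nhds]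
  intro μ hμ
  have h := ProbabilityMeasure.le_liminf_measure_open_of_tendsto
    (tendsto_id (α := ProbabilityMeasure S) (x := 𝓝 μ)) hU
  exact eventually_lt_of_lt_liminf (lt_of_lt_of_le hμ h)

theorem nhds_generateFrom_isCountablyGenerated {α : Type*} {s : Set (Set α)} (hs : s.Countable)
    (a : α) : (@nhds α (TopologicalSpace.generateFrom s) a).IsCountablyGenerated := by
  let _ : TopologicalSpace α := TopologicalSpace.generateFrom s
  have : SecondCountableTopology α := ⟨⟨s, hs, rfl⟩⟩
  infer_instance

theorem mem_nhds_generateFrom {α : Type*} {s : Set (Set α)} {u : Set α} (hu : u ∈ s) {a : α}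
    (ha : a ∈ u) : u ∈ @nhds α (TopologicalSpace.generateFrom s) a := by
  let _ : TopologicalSpace α := TopologicalSpace.generateFrom s
  exact (TopologicalSpace.isOpen_generateFrom_of_mem hu).mem_nhds ha

theorem weak_eq_generateFrom [TopologicalSpace.PseudoMetrizableSpace S]
    [SecondCountableTopology S] [OpensMeasurableSpace S] :
    (inferInstance : TopologicalSpace (ProbabilityMeasure S)) =
      TopologicalSpace.generateFrom (weakSubbasis S) := by
  let _ := TopologicalSpace.pseudoMetrizableSpacePseudoMetric S
  have hbase := TopologicalSpace.isBasis_countableBasis S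
  apply le_antisymm
  · apply le_generateFrom
    rintro _ ⟨⟨⟨F, hF, hFB⟩, q⟩, rfl⟩
    exact isOpen_setOf_lt_measure
      (isOpen_sUnion fun s hs => hbase.isOpen (hFB hs)) _
  · refine le_of_nhds_le_nhds fun μ => ?_
    have hcg := nhds_generateFrom_isCountablyGenerated (weakSubbasis_countable (S := S)) μ
    refine tendsto_of_forall_isOpen_le_liminf' (μs := fun ν => ν) fun U hU => ?_
    refine le_of_forall_lt_imp_le_of_dense fun c hc => ?_
    obtain ⟨q, hq0, hcq, hqU⟩ := ENNReal.lt_iff_exists_rat_btwn.1 hc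
    obtain ⟨T, hTB, hT, hTU⟩ := μ.exists_lt_measure_biUnion_of_isOpen
      (S := TopologicalSpace.countableBasis S)
      (fun V hV x hx => by
        obtain ⟨v, hv, hxv, hvV⟩ := hbase.exists_subset_of_mem_open hx hV
        exact ⟨v, hv, (hbase.isOpen hv).mem_nhds hxv, hvV⟩) hU
      (r := Real.toNNReal q) (by
        rw [← ProbabilityMeasure.ennreal_coeFn_eq_coeFn_toMeasure] at hqU
        exact_mod_cast hqU)
    refine le_liminf_of_le (by isBoundedDefault) ?_
    have hmem : {ν : ProbabilityMeasure S | ENNReal.ofReal (q : ℝ) < (ν : Measure S) (⋃₀ ↑T)} ∈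
        @nhds _ (TopologicalSpace.generateFrom (weakSubbasis S)) μ := by
      refine mem_nhds_generateFrom (s := weakSubbasis S)
        (Set.mem_range_self (⟨(T : Set (Set S)), T.finite_toSet, hTB⟩, q)) ?_
      change ENNReal.ofReal (q : ℝ) < (μ : Measure S) (⋃₀ ↑T)
      rw [Set.sUnion_eq_biUnion, ← ProbabilityMeasure.ennreal_coeFn_eq_coeFn_toMeasure]
      exact ENNReal.coe_lt_coe.2 hT
    filter_upwards [hmem] with ν hν
    refine hcq.le.trans (le_of_lt (lt_of_lt_of_le hν (measure_mono ?_)))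
    simpa [Set.sUnion_eq_biUnion] using hTU

instance instBorelSpaceProbabilityMeasure [TopologicalSpace.PseudoMetrizableSpace S]
    [SecondCountableTopology S] [BorelSpace S] : BorelSpace (ProbabilityMeasure S) where
  measurable_eq := by
    let _ := TopologicalSpace.pseudoMetrizableSpacePseudoMetric S
    apply le_antisymm
    · have h : @Measurable _ _ (borel (ProbabilityMeasure S)) _
          (fun μ : ProbabilityMeasure S => (μ : Measure S)) := by
        refine @Measurable.measure_of_isPiSystem_of_isProbabilityMeasure _ _
          (borel (ProbabilityMeasure S)) _ _ (fun μ => inferInstance) {s | IsOpen s}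
          (BorelSpace.measurable_eq) isPiSystem_isOpen fun U hU => ?_
        let _ : MeasurableSpace (ProbabilityMeasure S) := borel (ProbabilityMeasure S)
        refine measurable_of_Ioi fun c => ?_
        exact MeasurableSpace.measurableSet_generateFrom (isOpen_setOf_lt_measure hU c)
      exact h.comap_le
    · have : SecondCountableTopology (ProbabilityMeasure S) :=
        ⟨⟨_, weakSubbasis_countable, weak_eq_generateFrom⟩⟩
      rw [borel_eq_generateFrom_of_subbasis weak_eq_generateFrom]
      apply MeasurableSpace.generateFrom_le
      rintro _ ⟨⟨⟨F, hF, hFB⟩, q⟩, rfl⟩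
      have hU : MeasurableSet (⋃₀ F) := (isOpen_sUnion fun s hs =>
        (TopologicalSpace.isBasis_countableBasis S).isOpen (hFB hs)).measurableSet
      exact measurableSet_lt measurable_const
        ((Measure.measurable_coe hU).comp measurable_subtype_coe)

end WeakBorel

/-- The index set of sequences of length `k ∈ {0, 1, …, ∞}`; indices start at `0`. -/
abbrev Idx (k : ℕ∞) : Type := {n : ℕ // (n : ℕ∞) < k}

/-- Vertices of the `d`-ary tree: finite words over the alphabet `Idx d`. -/
abbrev Word (d : ℕ∞) : Type := List (Idx d)

/-- A family of maps `γ[ω] : S ^ κ(ω) → S`, jointly measurable in `ω` and `x` on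
`{κ = k} × S ^ k` for every `k ∈ {0, 1, …, ∞}`. -/
structure RandomMap (Ω S : Type*) [MeasurableSpace Ω] [MeasurableSpace S] where
  κ : Ω → ℕ∞
  measurable_κ : Measurable κ
  γ : (ω : Ω) → (Idx (κ ω) → S) → S
  measurable_γ : ∀ k : ℕ∞, Measurable fun p : {ω : Ω // κ ω = k} × (Idx k → S) =>
    γ p.1.1 fun j => p.2 ⟨j.1, lt_of_lt_of_eq j.2 p.1.2⟩

section Maps

variable {Ω S : Type*} [MeasurableSpace Ω] [MeasurableSpace S]

/-- `ǧ(μ₁, …, μₖ)`: the image of the product measure `μ₁ ⊗ ⋯ ⊗ μₖ` under `g`. -/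
noncomputable def checkMap {k : ℕ∞} (g : (Idx k → S) → S) (hg : Measurable g)
    (ξ : Idx k → ProbabilityMeasure S) : ProbabilityMeasure S :=
  ⟨(Measure.infinitePi fun j => (ξ j : Measure S)).map g,
    Measure.isProbabilityMeasure_map hg.aemeasurable⟩

/-- `T_g(μ) = ǧ(μ, …, μ)`. -/
noncomputable def mapT {k : ℕ∞} (g : (Idx k → S) → S) (hg : Measurable g)
    (μ : ProbabilityMeasure S) : ProbabilityMeasure S :=
  checkMap g hg fun _ => μ

theorem measurable_infinitePi {ι : Type*} :
    Measurable fun ξ : ι → ProbabilityMeasure S =>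
      Measure.infinitePi fun i => (ξ i : Measure S) := by
  refine Measurable.measure_of_isPiSystem_of_isProbabilityMeasure
    generateFrom_squareCylinders.symm
    (isPiSystem_squareCylinders (fun _ => MeasurableSpace.isPiSystem_measurableSet)
      (fun _ => MeasurableSet.univ)) ?_
  rintro _ ⟨s, t, ht, rfl⟩
  have ht' : ∀ i ∈ s, MeasurableSet (t i) := fun i _ => ht i (Set.mem_univ i)
  simp_rw [Measure.infinitePi_pi _ ht']
  exact Finset.measurable_prod _ fun i hi =>
    (Measure.measurable_coe (ht' i hi)).comp
      (measurable_subtype_coe.comp (measurable_pi_apply i))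

namespace RandomMap

variable (G : RandomMap Ω S)

theorem measurable_map (ω : Ω) : Measurable (G.γ ω) :=
  (G.measurable_γ (G.κ ω)).comp
    (measurable_const.prodMk measurable_id : Measurable fun x : Idx (G.κ ω) → S =>
      ((⟨ω, rfl⟩ : {ω' : Ω // G.κ ω' = G.κ ω}), x))

theorem checkMap_cast {k : ℕ∞} (ω : Ω) (h : G.κ ω = k) (ξ : Idx k → ProbabilityMeasure S) :
    (checkMap (G.γ ω) (G.measurable_map ω) fun j => ξ ⟨j.1, lt_of_lt_of_eq j.2 h⟩ : Measure S) =
      (Measure.infinitePi fun j => (ξ j : Measure S)).map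
        fun x => G.γ ω fun j => x ⟨j.1, lt_of_lt_of_eq j.2 h⟩ := by
  subst h
  rfl

theorem measurable_checkMap (k : ℕ∞) :
    Measurable fun p : {ω : Ω // G.κ ω = k} × (Idx k → ProbabilityMeasure S) =>
      checkMap (G.γ p.1.1) (G.measurable_map p.1.1)
        fun j => p.2 ⟨j.1, lt_of_lt_of_eq j.2 p.1.2⟩ := by
  refine Measurable.subtype_mk (Measure.measurable_of_measurable_coe _ fun A hA => ?_)
  let K : Kernel ({ω : Ω // G.κ ω = k} × (Idx k → ProbabilityMeasure S)) (Idx k → S) :=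
    ⟨fun p => Measure.infinitePi fun j => (p.2 j : Measure S),
      measurable_infinitePi.comp measurable_snd⟩
  have : IsMarkovKernel K := ⟨fun p => by
    change IsProbabilityMeasure (Measure.infinitePi fun j => (p.2 j : Measure S))
    infer_instance⟩
  have hf := G.measurable_γ k
  have hf' : Measurable fun q :
      ({ω : Ω // G.κ ω = k} × (Idx k → ProbabilityMeasure S)) × (Idx k → S) =>
      G.γ q.1.1.1 fun j => q.2 ⟨j.1, lt_of_lt_of_eq j.2 q.1.1.2⟩ :=
    hf.comp ((measurable_fst.comp measurable_fst).prodMk measurable_snd)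
  have hK := Kernel.measurable_kernel_prodMk_left (κ := K) (hf' hA)
  refine Eq.subst (motive := fun f => Measurable f) (funext fun p => ?_) hK
  refine ((DFunLike.congr_fun (G.checkMap_cast p.1.1 p.1.2 p.2) A).trans ?_).symm
  have hm : Measurable fun x : Idx k → S =>
      G.γ p.1.1 fun j => x ⟨j.1, lt_of_lt_of_eq j.2 p.1.2⟩ :=
    hf'.comp (measurable_prodMk_left (x := p))
  rw [Measure.map_apply hm hA]
  rfl

/-- The map `γ̌`, with `γ̌[ω]` the map `ǧ` for `g = γ[ω]`. -/
noncomputable def check : RandomMap Ω (ProbabilityMeasure S) where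
  κ := G.κ
  measurable_κ := G.measurable_κ
  γ ω := checkMap (G.γ ω) (G.measurable_map ω)
  measurable_γ := G.measurable_checkMap

theorem measurable_mapT (μ : ProbabilityMeasure S) :
    Measurable fun ω => (mapT (G.γ ω) (G.measurable_map ω) μ : Measure S) := by
  have h : ∀ k : ℕ∞, Measurable fun ω : {ω : Ω // G.κ ω = k} =>
      (mapT (G.γ ω.1) (G.measurable_map ω.1) μ : Measure S) := fun k =>
    measurable_subtype_coe.comp ((G.measurable_checkMap k).comp
      ((measurable_id (α := {ω : Ω // G.κ ω = k})).prodMk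
        (measurable_const (a := fun _ : Idx k => μ))))
  intro B hB
  have hunion : (fun ω => (mapT (G.γ ω) (G.measurable_map ω) μ : Measure S)) ⁻¹' B =
      ⋃ k : ℕ∞, Subtype.val '' ((fun ω : {ω : Ω // G.κ ω = k} =>
        (mapT (G.γ ω.1) (G.measurable_map ω.1) μ : Measure S)) ⁻¹' B) := by
    ext ω
    simp
  rw [hunion]
  exact MeasurableSet.iUnion fun k =>
    (G.measurable_κ (measurableSet_singleton k)).subtype_image (h k hB)

/-- `T(μ) = ∫ r(dω) T_{γ[ω]}(μ)`. -/
noncomputable def T (r : ProbabilityMeasure Ω) (μ : ProbabilityMeasure S) :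
    ProbabilityMeasure S :=
  ⟨(r : Measure Ω).bind fun ω => (mapT (G.γ ω) (G.measurable_map ω) μ : Measure S),
    isProbabilityMeasure_bind (G.measurable_mapT μ).aemeasurable
      (Eventually.of_forall fun _ => inferInstance)⟩

end RandomMap

/-- `(ω_i, X_i)` is a Recursive Tree Process on the `d`-ary tree, corresponding to the map `γ`
(with `κ ≤ d`), the law `r` of the randomness, and the solution `μ` of `T(μ) = μ`.
The word `i ++ [j]` is the `j`-th child of `i`; the words of length `t` form the boundary of
`{i : |i| < t}`. -/
structure IsRTP {d : ℕ∞} (G : RandomMap Ω S) (hκ : ∀ ω, G.κ ω ≤ d)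
    (r : ProbabilityMeasure Ω) (μ : ProbabilityMeasure S)
    {E : Type*} [MeasurableSpace E] (P : Measure E)
    (w : Word d → E → Ω) (X : Word d → E → S) : Prop where
  solution : G.T r μ = μ
  measurable_w : ∀ i, Measurable (w i)
  measurable_X : ∀ i, Measurable (X i)
  indep_w : iIndepFun w P
  law_w : ∀ i, P.map (w i) = (r : Measure Ω)
  indep_X : ∀ t : ℕ, 1 ≤ t → iIndepFun (fun i : {i : Word d // i.length = t} => X i.1) P
  law_X : ∀ i : Word d, 1 ≤ i.length → P.map (X i) = (μ : Measure S)
  indep_X_w : ∀ t : ℕ, 1 ≤ t → IndepFun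
    (fun e => fun i : {i : Word d // i.length = t} => X i.1 e)
    (fun e => fun i : {i : Word d // i.length < t} => w i.1 e) P
  recursion : ∀ i, ∀ᵐ e ∂P,
    X i e = G.γ (w i e) fun j => X (i ++ [⟨j.1, lt_of_lt_of_le j.2 (hκ (w i e))⟩]) e

/-- `ξ` is a version of the conditional law `P[X ∈ · | F]`. -/
structure IsCondLaw {E : Type*} [MeasurableSpace E] (P : Measure E) (F : MeasurableSpace E)
    (X : E → S) (ξ : E → ProbabilityMeasure S) : Prop where
  measurable : Measurable[F] ξ
  ae_eq : ∀ A : Set S, MeasurableSet A →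
    (fun e => (ξ e : Measure S).real A) =ᵐ[P] P[(X ⁻¹' A).indicator (fun _ => (1 : ℝ)) | F]

/-- The sigma-algebra generated by `(ω_{ij})`, with `j` ranging over all words. -/
abbrev subtreeSigma {d : ℕ∞} {E : Type*} (w : Word d → E → Ω) (i : Word d) : MeasurableSpace E :=
  ⨆ j : Word d, MeasurableSpace.comap (w (i ++ j)) inferInstance

/-- In a Polish space such conditional laws exist. -/
theorem exists_isCondLaw [StandardBorelSpace S] {d : ℕ∞} {E : Type*} [MeasurableSpace E]
    (P : Measure E) [IsProbabilityMeasure P] {w : Word d → E → Ω} (hw : ∀ i, Measurable (w i))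
    {X : E → S} (hX : Measurable X) (i : Word d) :
    ∃ ξ, IsCondLaw P (subtreeSigma w i) X ξ := by
  obtain ⟨e₀⟩ : Nonempty E := P.nonempty_of_neZero
  have : Nonempty S := ⟨X e₀⟩
  let Y : E → Word d → Ω := fun e j => w (i ++ j) e
  have hY : Measurable Y := measurable_pi_lambda _ fun j => hw _
  have hσ : subtreeSigma w i = MeasurableSpace.comap Y MeasurableSpace.pi := by
    simp only [MeasurableSpace.pi, MeasurableSpace.comap_iSup, MeasurableSpace.comap_comp]
    rfl
  refine ⟨fun e => ⟨condDistrib X Y P (Y e), inferInstance⟩, ?_, fun A hA => ?_⟩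
  · rw [hσ]
    exact (((condDistrib X Y P).measurable).comp (comap_measurable Y)).subtype_mk
  · rw [hσ]
    exact condDistrib_ae_eq_condExp hY hX hA

/-- `ρ` is the weak limit of `Ť^t(δ_μ)` as `t → ∞`. -/
def IsLowerLimit [TopologicalSpace S] [PolishSpace S] [BorelSpace S]
    (G : RandomMap Ω S) (r : ProbabilityMeasure Ω) (μ : ProbabilityMeasure S)
    (ρ : ProbabilityMeasure (ProbabilityMeasure S)) : Prop :=
  Tendsto (fun t : ℕ => (G.check.T r)^[t] (diracProba μ)) atTop (𝓝 ρ)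

theorem measurable_diracProba : Measurable (diracProba : S → ProbabilityMeasure S) :=
  Measure.measurable_dirac.subtype_mk

/-- The law of `δ_X` where `X` has law `μ`. -/
noncomputable def upper (μ : ProbabilityMeasure S) :
    ProbabilityMeasure (ProbabilityMeasure S) :=
  μ.map measurable_diracProba.aemeasurable

end Maps

end RecTree

/-!
The randomness `w` below a level `t` and the pairs (value `X i`, randomness in the subtree of `i`)
for `|i| = t` are all independent (`IsRTP.iIndep_levelSigma`). The definition only gives the
independence of the values of one level from the randomness below it; but almost surely `X i` is a
function of the randomness in `n` generations of its subtree and of the values at their boundary,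
and cutting the tree at level `t + n` makes all of these independent. Letting `n → ∞` is a
`π`-system argument. Hence any process which at each vertex is a function of the value and the
randomness in the subtree is a recursive tree process as soon as it has the right law at
each vertex and satisfies the recursion (`IsRTP.of_measurable`); the solution equation comes from
the recursion, because `T` describes the law of `γ[w](Y)` for i.i.d. `Y` independent of `w`
(`map_extend_eq_T`).

For the Dirac masses the recursion is the identity `γ̌[ω](δ_{x₁}, …) = δ_{γ[ω](x₁, …)}`.

For the conditional laws `ξ i`, independence makes `γ̌[w i](ξ i1, …)` a version of the conditional
law of `γ[w i](X i1, …)` (`isCondLaw_extend`), and versions are almost surely equal. The same fact,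
applied `n` times to the constant `μ`, shows that the conditional law of `X i` given `n`
generations of the subtree is given by the recursion for `γ̌`, so that its law is `Ťⁿ(δ_μ)`. By
Lévy's upward theorem, applied to the countably many open sets that determine the weak topology,
these conditional laws converge to `ξ i` almost surely. So `Ťⁿ(δ_μ)` converges weakly to the law
of `ξ i`, which is therefore the same for all vertices other than the root.
-/

namespace RecTree

/-! ### Independence and conditional laws -/

section Independence

variable {E : Type*} [mE : MeasurableSpace E] {P : Measure E}

/-- Disjoint blocks of an independent family of sigma-algebras are independent. -/
theorem iIndep_iSup_of_disjoint {ι κ : Type*} {m : ι → MeasurableSpace E}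
    (hle : ∀ i, m i ≤ mE) (h : iIndep m P) {S : κ → Set ι}
    (hS : Pairwise fun a b => Disjoint (S a) (S b)) :
    iIndep (fun k => ⨆ i ∈ S k, m i) P := by
  classical
  have := h.isProbabilityMeasure
  rw [iIndep_iff]
  intro s f hf
  induction s using Finset.induction_on with
  | empty => simp
  | insert a s ha ih =>
    rw [Finset.set_biInter_insert, Finset.prod_insert ha,
      ← ih fun i hi => hf i (Finset.mem_insert_of_mem hi)]
    have hd : Disjoint (S a) (⋃ k ∈ s, S k) := by
      rw [Set.disjoint_iUnion₂_right]
      exact fun k hk => hS fun hak => ha (hak ▸ hk)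
    refine (Indep_iff _ _ _).1 (indep_iSup_of_disjoint hle h hd) _ _
      (hf a (Finset.mem_insert_self a s)) ?_
    refine Finset.measurableSet_biInter s fun k hk => ?_
    refine (?_ : ⨆ i ∈ S k, m i ≤ ⨆ i ∈ ⋃ k ∈ s, S k, m i) _
      (hf k (Finset.mem_insert_of_mem hk))
    exact biSup_mono fun i hi => Set.mem_biUnion hk hi

/-- A family is independent if its restrictions to a set of indices and to the complement are
independent families, independent of each other. -/
theorem iIndep_of_split {ι : Type*} {m : ι → MeasurableSpace E} (p : ι → Prop)
    (h₁ : iIndep (fun i : {i // p i} => m i) P) (h₂ : iIndep (fun i : {i // ¬ p i} => m i) P)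
    (h : Indep (⨆ i : {i // p i}, m i) (⨆ i : {i // ¬ p i}, m i) P) : iIndep m P := by
  classical
  rw [iIndep_iff]
  intro s f hf
  have hsplit : (⋂ i ∈ s, f i) =
      (⋂ i ∈ s.subtype p, f i) ∩ ⋂ i ∈ s.subtype fun i => ¬ p i, f i := by
    ext e
    simp only [Set.mem_iInter, Set.mem_inter_iff, Finset.mem_subtype]
    refine ⟨fun h => ⟨fun i hi => h i hi, fun i hi => h i hi⟩, fun h i hi => ?_⟩
    by_cases hp : p i
    · exact h.1 ⟨i, hp⟩ hi
    · exact h.2 ⟨i, hp⟩ hi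
  have hf₁ : ∀ i ∈ s.subtype p, MeasurableSet[m i] (f i) := fun i hi =>
    hf i (Finset.mem_subtype.1 hi)
  have hf₂ : ∀ i ∈ s.subtype fun i => ¬ p i, MeasurableSet[m i] (f i) := fun i hi =>
    hf i (Finset.mem_subtype.1 hi)
  rw [hsplit, (Indep_iff _ _ _).1 h _ _
      (Finset.measurableSet_biInter _ fun i hi =>
        le_iSup (fun i : {i // p i} => m i) i _ (hf₁ i hi))
      (Finset.measurableSet_biInter _ fun i hi =>
        le_iSup (fun i : {i // ¬ p i} => m i) i _ (hf₂ i hi)),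
    (iIndep_iff _ _).1 h₁ _ hf₁, (iIndep_iff _ _).1 h₂ _ hf₂,
    Finset.prod_subtype_eq_prod_filter (fun i => P (f i)),
    Finset.prod_subtype_eq_prod_filter (fun i => P (f i)),
    Finset.prod_filter_mul_prod_filter_not]

/-- If `K (z e)` has the right masses on a pair of generating `π`-systems, then it is the
conditional law of `Y` given `z`, and the conditional law of a function of `z` and `Y` is
obtained by freezing `z`. -/
theorem measure_inter_preimage_eq_lintegral {Z T S : Type*} [mZ : MeasurableSpace Z]
    [mT : MeasurableSpace T] [MeasurableSpace S] [IsProbabilityMeasure P] {z : E → Z}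
    (hz : Measurable z) {Y : E → T} (hY : Measurable Y) {K : Z → ProbabilityMeasure T}
    (hK : Measurable K) {C : Set (Set Z)} {D : Set (Set T)}
    (hC : MeasurableSpace.generateFrom C = mZ) (hCpi : IsPiSystem C) (hCu : Set.univ ∈ C)
    (hD : MeasurableSpace.generateFrom D = mT) (hDpi : IsPiSystem D) (hDu : Set.univ ∈ D)
    (h : ∀ B ∈ C, ∀ A ∈ D, P (z ⁻¹' B ∩ Y ⁻¹' A) = ∫⁻ e in z ⁻¹' B, (K (z e) : Measure T) A ∂P)
    {g : Z × T → S} (hg : Measurable g) {B : Set Z} (hB : MeasurableSet B) {A : Set S}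
    (hA : MeasurableSet A) :
    P (z ⁻¹' B ∩ (fun e => g (z e, Y e)) ⁻¹' A) =
      ∫⁻ e in z ⁻¹' B, (K (z e) : Measure T) ((fun y => g (z e, y)) ⁻¹' A) ∂P := by
  let κ : Kernel Z T := ⟨fun x => (K x : Measure T), measurable_subtype_coe.comp hK⟩
  have hκ : IsMarkovKernel κ := ⟨fun x => (K x).2⟩
  have : IsProbabilityMeasure (P.map z) := Measure.isProbabilityMeasure_map hz.aemeasurable
  have : IsProbabilityMeasure (P.map fun e => (z e, Y e)) :=
    Measure.isProbabilityMeasure_map (hz.prodMk hY).aemeasurable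
  have key : P.map (fun e => (z e, Y e)) = (P.map z) ⊗ₘ κ := by
    refine ext_of_generate_finite _
      (generateFrom_eq_prod hC hD ⟨fun _ => Set.univ, fun _ => hCu, Set.iUnion_const _⟩
        ⟨fun _ => Set.univ, fun _ => hDu, Set.iUnion_const _⟩).symm (hCpi.prod hDpi) ?_ (by simp)
    rintro _ ⟨B, hB, A, hA, rfl⟩
    have hBm : MeasurableSet B := hC ▸ MeasurableSpace.measurableSet_generateFrom hB
    have hAm : MeasurableSet A := hD ▸ MeasurableSpace.measurableSet_generateFrom hA
    rw [Measure.map_apply (hz.prodMk hY) (hBm.prod hAm), Measure.compProd_apply_prod hBm hAm,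
      setLIntegral_map hBm (κ.measurable_coe hAm) hz]
    exact h B hB A hA
  have hD : MeasurableSet (Prod.fst ⁻¹' B ∩ g ⁻¹' A) := (measurable_fst hB).inter (hg hA)
  have h1 := congrArg (fun ν => ν (Prod.fst ⁻¹' B ∩ g ⁻¹' A)) key
  rw [Measure.map_apply (hz.prodMk hY) hD, Measure.compProd_apply hD,
    lintegral_map (Kernel.measurable_kernel_prodMk_left hD) hz] at h1
  refine h1.trans ?_
  rw [← lintegral_indicator (hz hB)]
  refine lintegral_congr fun e => ?_
  by_cases he : z e ∈ B
  · rw [Set.indicator_of_mem (by exact he)]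
    refine congrArg (K (z e) : Measure T) (Set.ext fun y => ?_)
    simp [he]
  · rw [Set.indicator_of_notMem (by exact he)]
    have : Prod.mk (z e) ⁻¹' (Prod.fst ⁻¹' B ∩ g ⁻¹' A) = ∅ := Set.ext fun y => by simp [he]
    rw [this, measure_empty]

end Independence

section CondLaw

theorem measurable_apply_probabilityMeasure {E S : Type*} [MeasurableSpace E]
    [MeasurableSpace S] {ξ : E → ProbabilityMeasure S} {A : Set S} (hA : MeasurableSet A)
    (hξ : Measurable ξ) : Measurable fun e => (ξ e : Measure S) A :=
  (Measure.measurable_coe hA).comp (measurable_subtype_coe.comp hξ)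

theorem IsCondLaw.congr_ae {E S : Type*} {F : MeasurableSpace E} [MeasurableSpace E]
    {P : Measure E} [MeasurableSpace S] {X : E → S} {ξ : E → ProbabilityMeasure S}
    (h : IsCondLaw P F X ξ) {X' : E → S} (hXX' : X =ᵐ[P] X') :
    IsCondLaw P F X' ξ := by
  refine ⟨h.measurable, fun A hA => (h.ae_eq A hA).trans (condExp_congr_ae ?_)⟩
  filter_upwards [hXX'] with e he
  have hiff : e ∈ X ⁻¹' A ↔ e ∈ X' ⁻¹' A := by rw [Set.mem_preimage, Set.mem_preimage, he]
  by_cases hx : e ∈ X ⁻¹' A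
  · rw [Set.indicator_of_mem hx, Set.indicator_of_mem (hiff.1 hx)]
  · rw [Set.indicator_of_notMem hx, Set.indicator_of_notMem (mt hiff.2 hx)]

variable {E S : Type*} {F : MeasurableSpace E} [mE : MeasurableSpace E] {P : Measure E}
  [IsProbabilityMeasure P] [MeasurableSpace S] {X : E → S} {ξ : E → ProbabilityMeasure S}

theorem lintegral_coe_eq_ofReal (hξ : Measurable ξ) {A : Set S} (hA : MeasurableSet A)
    (B : Set E) :
    ∫⁻ e in B, (ξ e : Measure S) A ∂P =
      ENNReal.ofReal (∫ e in B, (ξ e : Measure S).real A ∂P) := by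
  rw [ofReal_integral_eq_lintegral_ofReal]
  · simp [Measure.real]
  · refine Integrable.of_bound
      (measurable_apply_probabilityMeasure hA hξ).ennreal_toReal.aestronglyMeasurable 1 ?_
    exact Eventually.of_forall fun e => by
      rw [Real.norm_of_nonneg measureReal_nonneg]; exact measureReal_le_one
  · exact Eventually.of_forall fun e => measureReal_nonneg

/-- The defining property of conditional laws in terms of masses, without conditional
expectations. -/
theorem isCondLaw_iff (hF : F ≤ mE) (hX : Measurable X) :
    IsCondLaw P F X ξ ↔ Measurable[F] ξ ∧ ∀ A : Set S, MeasurableSet A →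
      ∀ B : Set E, MeasurableSet[F] B →
        P (B ∩ X ⁻¹' A) = ∫⁻ e in B, (ξ e : Measure S) A ∂P := by
  have hint : ∀ A, MeasurableSet A → ∀ B, MeasurableSet[F] B →
      ∫ e in B, (X ⁻¹' A).indicator (fun _ => (1 : ℝ)) e ∂P = P.real (B ∩ X ⁻¹' A) := by
    intro A hA B hB
    rw [setIntegral_indicator (hX hA)]
    simp
  have hi : ∀ A, MeasurableSet A →
      Integrable ((X ⁻¹' A).indicator (fun _ => (1 : ℝ))) P := fun A hA =>
    (integrable_const _).indicator (hX hA)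
  constructor
  · rintro ⟨hm, h⟩
    refine ⟨hm, fun A hA B hB => ?_⟩
    rw [lintegral_coe_eq_ofReal (hm.mono hF le_rfl) hA,
      setIntegral_congr_ae (hF _ hB) ((h A hA).mono fun e he _ => he),
      setIntegral_condExp hF (hi A hA) hB, hint A hA B hB]
    simp
  · rintro ⟨hm, h⟩
    refine ⟨hm, fun A hA => ?_⟩
    have hmA : Measurable[F] fun e => (ξ e : Measure S).real A :=
      (@measurable_apply_probabilityMeasure E S F _ ξ A hA hm).ennreal_toReal
    have hmi : Integrable (fun e => (ξ e : Measure S).real A) P := by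
      refine Integrable.of_bound (hmA.mono hF le_rfl).aestronglyMeasurable 1 ?_
      exact Eventually.of_forall fun e => by
        rw [Real.norm_of_nonneg measureReal_nonneg]; exact measureReal_le_one
    refine ae_eq_condExp_of_forall_setIntegral_eq hF (hi A hA)
      (fun _ _ _ => hmi.integrableOn) (fun B hB _ => ?_) hmA.stronglyMeasurable.aestronglyMeasurable
    have h1 := h A hA B hB
    rw [lintegral_coe_eq_ofReal (hm.mono hF le_rfl) hA] at h1
    rw [hint A hA B hB, Measure.real, h1, ENNReal.toReal_ofReal]
    exact integral_nonneg fun e => measureReal_nonneg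

/-- Conditional laws given an increasing sequence of sigma-algebras converge weakly, almost
surely, to the conditional law given the limiting sigma-algebra: by Lévy's upward theorem the
masses of the countably many open sets that determine the weak topology converge. -/
theorem ae_tendsto_of_isCondLaw [TopologicalSpace S] [PolishSpace S] [BorelSpace S]
    (𝓕 : Filtration ℕ mE) {η : ℕ → E → ProbabilityMeasure S}
    (hη : ∀ n, IsCondLaw P (𝓕 n) X (η n)) (hξ : IsCondLaw P (⨆ n, 𝓕 n) X ξ) :
    ∀ᵐ e ∂P, Tendsto (fun n => η n e) atTop (𝓝 (ξ e)) := by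
  have hcount : Countable {F : Set (Set S) // F.Finite ∧
      F ⊆ TopologicalSpace.countableBasis S} :=
    (Set.countable_ofPred_finite_subset (TopologicalSpace.countable_countableBasis S)).to_subtype
  have hU : ∀ F : {F : Set (Set S) // F.Finite ∧ F ⊆ TopologicalSpace.countableBasis S},
      MeasurableSet (⋃₀ F.1) := fun F => (isOpen_sUnion fun s hs =>
        (TopologicalSpace.isBasis_countableBasis S).isOpen (F.2.2 hs)).measurableSet
  have h1 : ∀ᵐ e ∂P, ∀ F : {F : Set (Set S) // F.Finite ∧
      F ⊆ TopologicalSpace.countableBasis S},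
      Tendsto (fun n => (η n e : Measure S).real (⋃₀ F.1)) atTop
        (𝓝 ((ξ e : Measure S).real (⋃₀ F.1))) := by
    refine ae_all_iff.2 fun F => ?_
    filter_upwards [tendsto_ae_condExp (μ := P) (ℱ := 𝓕)
      ((X ⁻¹' ⋃₀ F.1).indicator fun _ => (1 : ℝ)), hξ.ae_eq _ (hU F),
      ae_all_iff.2 fun n => (hη n).ae_eq _ (hU F)] with e he h2 h3
    simp only [h2, h3]
    exact he
  filter_upwards [h1] with e he
  have key : Tendsto (fun n => η n e) atTop
      (@nhds _ (TopologicalSpace.generateFrom (weakSubbasis S)) (ξ e)) := by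
    rw [TopologicalSpace.tendsto_nhds_generateFrom_iff]
    rintro _ ⟨⟨F, q⟩, rfl⟩ hmem
    have h2 : Tendsto (fun n => (η n e : Measure S) (⋃₀ F.1)) atTop
        (𝓝 ((ξ e : Measure S) (⋃₀ F.1))) :=
      (ENNReal.tendsto_toReal_iff (fun n => measure_ne_top _ _) (measure_ne_top _ _)).1 (he F)
    exact h2.eventually_const_lt hmem
  rwa [← weak_eq_generateFrom] at key

/-- Versions of a conditional law are unique: apply the convergence theorem to constant
sequences. -/
theorem IsCondLaw.ae_unique [TopologicalSpace S] [PolishSpace S] [BorelSpace S] (hF : F ≤ mE)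
    (h : IsCondLaw P F X ξ) {ξ' : E → ProbabilityMeasure S}
    (h' : IsCondLaw P F X ξ') : ξ =ᵐ[P] ξ' := by
  filter_upwards [ae_tendsto_of_isCondLaw (Filtration.const ℕ F hF) (fun _ => h)
    (by simpa using h')] with e he
  exact tendsto_nhds_unique tendsto_const_nhds he

end CondLaw

/-! ### The maps `γ[ω]` on sequences indexed by the whole alphabet -/

section Extend

variable {Ω S : Type*} [MeasurableSpace Ω] [MeasurableSpace S] {d : ℕ∞}

/-- The map `γ[ω]`, regarded as a function of a sequence indexed by the whole alphabet of which
it reads the first `κ(ω)` entries only. -/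
def RandomMap.extend (G : RandomMap Ω S) (hκ : ∀ ω, G.κ ω ≤ d) (ω : Ω) (x : Idx d → S) : S :=
  G.γ ω fun j => x ⟨j.1, lt_of_lt_of_le j.2 (hκ ω)⟩

theorem measurable_extend (G : RandomMap Ω S) (hκ : ∀ ω, G.κ ω ≤ d) :
    Measurable fun p : Ω × (Idx d → S) => G.extend hκ p.1 p.2 := by
  have h : ∀ k : ℕ∞, Measurable fun p : {p : Ω × (Idx d → S) // G.κ p.1 = k} =>
      G.extend hκ p.1.1 p.1.2 := by
    intro k
    by_cases hk : k ≤ d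
    · have h1 : Measurable fun p : {p : Ω × (Idx d → S) // G.κ p.1 = k} =>
          ((⟨p.1.1, p.2⟩ : {ω : Ω // G.κ ω = k}),
            fun j : Idx k => p.1.2 ⟨j.1, lt_of_lt_of_le j.2 hk⟩) := by
        refine Measurable.prodMk ?_ ?_
        · exact (measurable_fst.comp measurable_subtype_coe).subtype_mk
        · exact measurable_pi_lambda _ fun j =>
            (measurable_pi_apply _).comp (measurable_snd.comp measurable_subtype_coe)
      exact (G.measurable_γ k).comp h1
    · have : IsEmpty {p : Ω × (Idx d → S) // G.κ p.1 = k} :=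
        ⟨fun p => hk (p.2 ▸ hκ p.1.1)⟩
      exact measurable_of_empty _
  intro B hB
  have hunion : (fun p : Ω × (Idx d → S) => G.extend hκ p.1 p.2) ⁻¹' B =
      ⋃ k : ℕ∞, Subtype.val '' ((fun p : {p : Ω × (Idx d → S) // G.κ p.1 = k} =>
        G.extend hκ p.1.1 p.1.2) ⁻¹' B) := by
    ext p
    simp
  rw [hunion]
  exact MeasurableSet.iUnion fun k =>
    ((G.measurable_κ.comp measurable_fst) (measurableSet_singleton k)).subtype_image (h k hB)

theorem measurable_extend_right (G : RandomMap Ω S) (hκ : ∀ ω, G.κ ω ≤ d) (ω : Ω) :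
    Measurable (G.extend hκ ω) :=
  (measurable_extend G hκ).comp measurable_prodMk_left

/-- `γ̌[ω](ξ)` is the image of the product over the whole alphabet: the entries that `γ[ω]` does
not read are integrated out. -/
theorem coe_check_extend (G : RandomMap Ω S) (hκ : ∀ ω, G.κ ω ≤ d) (ω : Ω)
    (ξ : Idx d → ProbabilityMeasure S) :
    (G.check.extend hκ ω ξ : Measure S) =
      (Measure.infinitePi fun j => (ξ j : Measure S)).map (G.extend hκ ω) := by
  let f : Idx (G.κ ω) → Idx d := fun j => ⟨j.1, lt_of_lt_of_le j.2 (hκ ω)⟩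
  have hf : Function.Injective f := fun a b hab =>
    Subtype.ext (congrArg (fun j : Idx d => j.1) hab)
  have h := Measure.map_infinitePi_infinitePi_of_inj (P := fun j => (ξ j : Measure S)) hf
  change (Measure.infinitePi fun j => (ξ (f j) : Measure S)).map (G.γ ω) = _
  rw [← h, Measure.map_map (G.measurable_map ω)
    (measurable_pi_lambda _ fun j => measurable_pi_apply _)]
  rfl

theorem check_extend_diracProba (G : RandomMap Ω S) (hκ : ∀ ω, G.κ ω ≤ d) (ω : Ω)
    (x : Idx d → S) :
    G.check.extend hκ ω (fun j => diracProba (x j)) = diracProba (G.extend hκ ω x) := by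
  refine Subtype.ext ((coe_check_extend G hκ ω _).trans ?_)
  change (Measure.infinitePi fun j => Measure.dirac (x j)).map (G.extend hκ ω) =
    Measure.dirac (G.extend hκ ω x)
  rw [Measure.infinitePi_dirac, Measure.map_dirac' (measurable_extend_right G hκ ω)]

theorem coe_T (G : RandomMap Ω S) (hκ : ∀ ω, G.κ ω ≤ d) (r : ProbabilityMeasure Ω)
    (ν : ProbabilityMeasure S) :
    (G.T r ν : Measure S) =
      ((r : Measure Ω).prod (Measure.infinitePi fun _ : Idx d => (ν : Measure S))).map
        (fun p => G.extend hκ p.1 p.2) := by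
  ext A hA
  rw [Measure.map_apply (measurable_extend G hκ) hA,
    Measure.prod_apply (measurable_extend G hκ hA)]
  change (r : Measure Ω).bind (fun ω => (mapT (G.γ ω) (G.measurable_map ω) ν : Measure S)) A = _
  rw [Measure.bind_apply hA (G.measurable_mapT ν).aemeasurable]
  refine lintegral_congr fun ω => ?_
  have h := coe_check_extend G hκ ω fun _ => ν
  change (mapT (G.γ ω) (G.measurable_map ω) ν : Measure S) = _ at h
  rw [h, Measure.map_apply (measurable_extend_right G hκ ω) hA]
  rfl

section Indep

variable {E : Type*} [mE : MeasurableSpace E] {P : Measure E} [IsProbabilityMeasure P]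

/-- The sigma-algebra generated by `w`, at `none`, together with sigma-algebras `F j` indexed by
the alphabet. In the tree these are the randomness at a vertex, and what the subtrees of its
children carry. -/
abbrev vertexSigma (w : E → Ω) (F : Idx d → MeasurableSpace E) :
    Option (Idx d) → MeasurableSpace E :=
  fun o => o.elim (MeasurableSpace.comap w inferInstance) F

/-- `T(ν)` is the law of `γ[w](Y)` where the `Y j` are i.i.d. with law `ν` and independent
of `w`. -/
theorem map_extend_eq_T (G : RandomMap Ω S) (hκ : ∀ ω, G.κ ω ≤ d) {r : ProbabilityMeasure Ω}
    {ν : ProbabilityMeasure S} {w : E → Ω} (hw : Measurable w) (hwr : P.map w = r)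
    {F : Idx d → MeasurableSpace E} (hF : ∀ j, F j ≤ mE) (hind : iIndep (vertexSigma w F) P)
    {Y : Idx d → E → S} (hY : ∀ j, Measurable[F j] (Y j)) (hYν : ∀ j, P.map (Y j) = ν) :
    P.map (fun e => G.extend hκ (w e) fun j => Y j e) = (G.T r ν : Measure S) := by
  have hYm : ∀ j, Measurable (Y j) := fun j => (hY j).mono (hF j) le_rfl
  have hYm' : Measurable fun e j => Y j e := measurable_pi_lambda _ hYm
  have hle : ∀ o, vertexSigma w F o ≤ mE := fun o => by
    cases o with
    | none => exact hw.comap_le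
    | some j => exact hF j
  have hYi : iIndepFun Y P := by
    refine iIndep_of_iIndep_of_le (hind.precomp (Option.some_injective (Idx d))) fun j => ?_
    exact (hY j).comap_le
  have hwY : IndepFun w (fun e j => Y j e) P := by
    have h := indep_iSup_of_disjoint hle hind (S := {none}) (T := Set.range some)
      (by simp)
    refine indep_of_indep_of_le h ?_ ?_
    · exact le_iSup₂_of_le (f := fun o _ => vertexSigma w F o) none rfl le_rfl
    · have hm : Measurable[⨆ o ∈ Set.range some, vertexSigma w F o] fun e j => Y j e := by
        refine @measurable_pi_lambda _ _ _ (_) _ _ fun j => (hY j).mono ?_ le_rfl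
        exact le_iSup₂_of_le (f := fun o _ => vertexSigma w F o) (some j) ⟨j, rfl⟩ le_rfl
      exact hm.comap_le
  rw [coe_T G hκ, ← hwr]
  have h1 : P.map (fun e j => Y j e) = Measure.infinitePi fun _ : Idx d => (ν : Measure S) := by
    have h := hYi.map_fun_eq_infinitePi_map hYm
    simp_rw [hYν] at h
    exact h
  rw [← h1, ← (indepFun_iff_map_prod_eq_prod_map_map hw.aemeasurable hYm'.aemeasurable).1 hwY,
    Measure.map_map (measurable_extend G hκ) (hw.prodMk hYm')]
  rfl

end Indep

end Extend

/-! ### Conditional laws under the maps `γ[ω]` -/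

section CondExtend

variable {Ω S E : Type*} [MeasurableSpace Ω] [MeasurableSpace S] {d : ℕ∞}
  [mE : MeasurableSpace E] {P : Measure E} [IsProbabilityMeasure P]

/-- Conditionally on the sigma-algebras of the subtrees, the values at the children are
independent with laws `ξ j`; this is the case of a box. -/
theorem measure_inter_pi_eq_lintegral {w : E → Ω} (hw : Measurable w)
    {F : Idx d → MeasurableSpace E} (hF : ∀ j, F j ≤ mE) {Y : Idx d → E → S}
    (hY : ∀ j, Measurable (Y j))
    (hind : iIndep (vertexSigma w fun j => MeasurableSpace.comap (Y j) inferInstance ⊔ F j) P)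
    {ξ : Idx d → E → ProbabilityMeasure S} (hξ : ∀ j, IsCondLaw P (F j) (Y j) (ξ j))
    (t : Finset (Option (Idx d))) (f : Option (Idx d) → Set E)
    (hf : ∀ o ∈ t, MeasurableSet[vertexSigma w F o] (f o))
    (s : Finset (Idx d)) (A : Idx d → Set S) (hA : ∀ j, MeasurableSet (A j)) :
    P ((⋂ o ∈ t, f o) ∩ {e | ∀ j ∈ s, Y j e ∈ A j}) =
      ∫⁻ e in ⋂ o ∈ t, f o, ∏ j ∈ s, (ξ j e : Measure S) (A j) ∂P := by
  classical
  -- Factors without a constraint get the full space, so that all products run over `u`.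
  let u : Finset (Option (Idx d)) := t ∪ s.map ⟨some, Option.some_injective _⟩
  let f' : Option (Idx d) → Set E := fun o => if o ∈ t then f o else Set.univ
  let A' : Idx d → Set S := fun j => if j ∈ s then A j else Set.univ
  let V : Option (Idx d) → Set E := fun o => o.elim Set.univ fun j => Y j ⁻¹' A' j
  let ζ : Option (Idx d) → E → ENNReal := fun o => o.elim 1 fun j e => (ξ j e : Measure S) (A' j)
  let m := vertexSigma w fun j => MeasurableSpace.comap (Y j) inferInstance ⊔ F j
  have hA' : ∀ j, MeasurableSet (A' j) := fun j => by
    by_cases hj : j ∈ s <;> simp [A', hj, hA]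
  have hlem : ∀ o, vertexSigma w F o ≤ m o := fun o => by
    cases o with
    | none => exact le_rfl
    | some j => exact le_sup_right
  have hmle : ∀ o, m o ≤ mE := fun o => by
    cases o with
    | none => exact hw.comap_le
    | some j => exact sup_le (hY j).comap_le (hF j)
  have hf' : ∀ o, MeasurableSet[vertexSigma w F o] (f' o) := fun o => by
    by_cases ho : o ∈ t
    · simpa [f', ho] using hf o ho
    · simp [f', ho]
  have hζ : ∀ o, Measurable[m o] (ζ o) := fun o => by
    cases o with
    | none => exact @measurable_const _ _ _ (m none) 1
    | some j =>
      exact (@measurable_apply_probabilityMeasure E S (F j) _ (ξ j) _ (hA' j)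
        (hξ j).measurable).mono le_sup_right le_rfl
  have hg : ∀ o, Measurable[m o] ((f' o).indicator (ζ o)) := fun o =>
    (hζ o).indicator (s := f' o) (hlem o _ (hf' o))
  have hV : ∀ o, MeasurableSet[m o] (V o) := fun o => by
    cases o with
    | none => exact @MeasurableSet.univ _ (m none)
    | some j => exact (le_sup_left : _ ≤ m (some j)) _ ⟨A' j, hA' j, rfl⟩
  have hone : ∀ o, P (f' o ∩ V o) = ∫⁻ e, (f' o).indicator (ζ o) e ∂P := fun o => by
    rw [lintegral_indicator (hmle o _ (hlem o _ (hf' o)))]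
    cases o with
    | none => simp [V, ζ]
    | some j => exact ((isCondLaw_iff (hF j) (hY j)).1 (hξ j)).2 _ (hA' j) _ (hf' (some j))
  have hL : (⋂ o ∈ t, f o) ∩ {e | ∀ j ∈ s, Y j e ∈ A j} = ⋂ o ∈ u, f' o ∩ V o := by
    ext e
    simp only [Set.mem_inter_iff, Set.mem_iInter, Set.mem_ofPred_eq]
    constructor
    · rintro ⟨h1, h2⟩ o -
      refine ⟨?_, ?_⟩
      · by_cases ho : o ∈ t <;> simp [f', ho, h1]
      · cases o with
        | none => trivial
        | some j =>
          change Y j e ∈ A' j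
          by_cases hj : j ∈ s <;> simp [A', hj, h2]
    · intro h
      refine ⟨fun o ho => ?_, fun j hj => ?_⟩
      · simpa [f', ho] using (h o (Finset.mem_union_left _ ho)).1
      · have : Y j e ∈ A' j :=
          (h (some j) (Finset.mem_union_right _ (Finset.mem_map.2 ⟨j, hj, rfl⟩))).2
        simpa [A', hj] using this
  have hR : ∀ e, (⋂ o ∈ t, f o).indicator (fun e => ∏ j ∈ s, (ξ j e : Measure S) (A j)) e =
      ∏ o ∈ u, (f' o).indicator (ζ o) e := by
    intro e
    by_cases he : e ∈ ⋂ o ∈ t, f o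
    · have h1 : ∀ o, e ∈ f' o := fun o => by
        by_cases ho : o ∈ t
        · simpa [f', ho] using Set.mem_iInter₂.1 he o ho
        · simp [f', ho]
      rw [Set.indicator_of_mem he,
        Finset.prod_congr rfl fun o _ => Set.indicator_of_mem (h1 o) (ζ o)]
      have h2 : ∏ o ∈ s.map ⟨some, Option.some_injective _⟩, ζ o e = ∏ o ∈ u, ζ o e := by
        refine Finset.prod_subset Finset.subset_union_right fun o _ ho => ?_
        cases o with
        | none => rfl
        | some j =>
          have hj : j ∉ s := fun hj => ho (Finset.mem_map.2 ⟨j, hj, rfl⟩)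
          simp [ζ, A', hj]
      rw [← h2, Finset.prod_map]
      refine Finset.prod_congr rfl fun j hj => ?_
      simp [ζ, A', hj]
    · rw [Set.indicator_of_notMem he]
      obtain ⟨o, ho, heo⟩ : ∃ o ∈ t, e ∉ f o := by simpa using he
      refine (Finset.prod_eq_zero (Finset.mem_union_left _ ho) ?_).symm
      exact Set.indicator_of_notMem (by simpa [f', ho] using heo) _
  have hB : MeasurableSet (⋂ o ∈ t, f o) :=
    Finset.measurableSet_biInter t fun o ho => hmle o _ (hlem o _ (hf o ho))
  rw [← lintegral_indicator hB, lintegral_congr hR,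
    lintegral_prod_eq_prod_lintegral_of_indepFun u _ ?_ fun o => (hg o).mono (hmle o) le_rfl,
    hL, (iIndep_iff _ _).1 hind u fun o _ => (hlem o _ (hf' o)).inter (hV o)]
  · exact Finset.prod_congr rfl fun o _ => hone o
  · exact iIndep_of_iIndep_of_le hind fun o => (hg o).comap_le

end CondExtend

/-- If `ξ j` is the conditional law of `Y j` given `F j`, where the `σ(Y j) ⊔ F j` are
independent of each other and of `w`, then `γ̌[w](ξ)` is the conditional law of `γ[w](Y)` given
`w` and all `F j`. The sub-sigma-algebra `H` is bound before the ambient one, so that instance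
resolution finds the latter. -/
theorem isCondLaw_extend {Ω S E : Type*} {d : ℕ∞} {H : MeasurableSpace E}
    [MeasurableSpace Ω] [MeasurableSpace S] [mE : MeasurableSpace E] {P : Measure E}
    [IsProbabilityMeasure P] (G : RandomMap Ω S) (hκ : ∀ ω, G.κ ω ≤ d) {w : E → Ω}
    (hw : Measurable w)
    {F : Idx d → MeasurableSpace E} (hF : ∀ j, F j ≤ mE) (hH : H = ⨆ o, vertexSigma w F o)
    {Y : Idx d → E → S} (hY : ∀ j, Measurable (Y j))
    (hind : iIndep (vertexSigma w fun j => MeasurableSpace.comap (Y j) inferInstance ⊔ F j) P)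
    {ξ : Idx d → E → ProbabilityMeasure S} (hξ : ∀ j, IsCondLaw P (F j) (Y j) (ξ j)) :
    IsCondLaw P H (fun e => G.extend hκ (w e) fun j => Y j e)
      (fun e => G.check.extend hκ (w e) fun j => ξ j e) := by
  have hHle : H ≤ mE := hH ▸ iSup_le fun o => by
    cases o with
    | none => exact hw.comap_le
    | some j => exact hF j
  have hwH : Measurable[H] w :=
    (comap_measurable w).mono (hH ▸ le_iSup (vertexSigma w F) none) le_rfl
  have hξH : ∀ j, Measurable[H] (ξ j) := fun j =>
    (hξ j).measurable.mono (hH ▸ le_iSup (vertexSigma w F) (some j)) le_rfl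
  have hξH' : Measurable[H] fun e j => ξ j e := @measurable_pi_lambda _ _ _ H _ _ hξH
  have hYm : Measurable fun e j => Y j e := measurable_pi_lambda _ hY
  have hXm : Measurable fun e => G.extend hκ (w e) fun j => Y j e :=
    (measurable_extend G hκ).comp (hw.prodMk hYm)
  have hξm : Measurable[H] fun e => G.check.extend hκ (w e) fun j => ξ j e :=
    (measurable_extend G.check hκ).comp
      (hwH.prodMk hξH')
  have hg : @Measurable (E × (Idx d → S)) S (@Prod.instMeasurableSpace _ _ H _) _
      fun p => G.extend hκ (w p.1) p.2 :=
    (measurable_extend G hκ).comp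
      ((hwH.comp (@measurable_fst _ _ H _)).prodMk (@measurable_snd _ _ H _))
  refine (isCondLaw_iff hHle hXm).2 ⟨hξm, fun A hA B hB => ?_⟩
  have key := @measure_inter_preimage_eq_lintegral E mE P E (Idx d → S) S H _ _ _ id
    (measurable_id'' hHle) _ hYm
    (fun e => ⟨Measure.infinitePi fun j => (ξ j e : Measure S), inferInstance⟩)
    (measurable_infinitePi.comp hξH').subtype_mk
    (piiUnionInter (fun o => {s | MeasurableSet[vertexSigma w F o] s}) Set.univ)
    (squareCylinders fun _ : Idx d => {s : Set S | MeasurableSet s})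
    ((generateFrom_piiUnionInter_measurableSet (vertexSigma w F) Set.univ).trans
      (by rw [hH]; simp))
    (isPiSystem_piiUnionInter _ (fun o => @MeasurableSpace.isPiSystem_measurableSet _
      (vertexSigma w F o)) _)
    ⟨∅, by simp, fun _ => Set.univ, by simp, by simp⟩
    generateFrom_squareCylinders
    (isPiSystem_squareCylinders (fun _ => MeasurableSpace.isPiSystem_measurableSet)
      fun _ => MeasurableSet.univ)
    ⟨∅, fun _ => Set.univ, by simp, by simp⟩ (by
      rintro _ ⟨t, -, f, hf, rfl⟩ _ ⟨s, A, hA, rfl⟩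
      have hA' : ∀ j, MeasurableSet (A j) := fun j => hA j (Set.mem_univ j)
      refine (measure_inter_pi_eq_lintegral hw hF hY hind hξ t f hf s A hA').trans ?_
      refine lintegral_congr fun e => ?_
      exact (Measure.infinitePi_pi _ fun j _ => hA' j).symm)
    _ hg B hB A hA
  refine key.trans (lintegral_congr fun e => ?_)
  rw [coe_check_extend, Measure.map_apply (measurable_extend_right G hκ _) hA]
  rfl

/-! ### Independence in a recursive tree process -/

section Tree

variable {Ω S E : Type*} [MeasurableSpace Ω] [MeasurableSpace S] {d : ℕ∞}

/-- The value at `i` computed by the recursion from boundary values `Z` at the words `i ++ j`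
with `|j| = n`. -/
def evalTree (G : RandomMap Ω S) (hκ : ∀ ω, G.κ ω ≤ d) (w : Word d → E → Ω)
    (Z : Word d → E → S) : ℕ → Word d → E → S
  | 0 => Z
  | n + 1 => fun i e => G.extend hκ (w i e) fun j => evalTree G hκ w Z n (i ++ [j]) e

theorem measurable_evalTree (mE : MeasurableSpace E) (G : RandomMap Ω S) (hκ : ∀ ω, G.κ ω ≤ d)
    {w : Word d → E → Ω} {Z : Word d → E → S} (n : ℕ) (i : Word d)
    (hw : ∀ j : Word d, j.length < n → Measurable (w (i ++ j)))
    (hZ : ∀ j : Word d, j.length = n → Measurable (Z (i ++ j))) :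
    Measurable (evalTree G hκ w Z n i) := by
  induction n generalizing i with
  | zero =>
    change Measurable (Z i)
    simpa using hZ [] rfl
  | succ n ih =>
    refine (measurable_extend G hκ).comp (Measurable.prodMk ?_ (measurable_pi_lambda _ fun j => ?_))
    · simpa using hw [] (Nat.succ_pos n)
    · refine ih _ (fun k hk => ?_) fun k hk => ?_
      · rw [List.append_assoc]
        exact hw _ (by simpa using hk)
      · rw [List.append_assoc]
        exact hZ _ (by simpa using hk)

/-- The sigma-algebra generated by the first `n` generations of the subtree rooted at `i`. -/
abbrev truncSigma (w : Word d → E → Ω) (n : ℕ) (i : Word d) : MeasurableSpace E :=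
  ⨆ j : {j : Word d // j.length < n}, MeasurableSpace.comap (w (i ++ j.1)) inferInstance

theorem truncSigma_mono (w : Word d → E → Ω) (i : Word d) :
    Monotone fun n => truncSigma w n i := fun _ _ hmn =>
  iSup_le fun j => le_iSup_of_le (ι := Subtype _) ⟨j.1, j.2.trans_le hmn⟩ le_rfl

theorem iSup_truncSigma (w : Word d → E → Ω) (i : Word d) :
    ⨆ n, truncSigma w n i = subtreeSigma w i := by
  refine le_antisymm (iSup_le fun n => iSup_le fun j => le_iSup_of_le j.1 le_rfl)
    (iSup_le fun j => ?_)
  exact le_iSup_of_le (j.length + 1)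
    (le_iSup_of_le (ι := Subtype _) ⟨j, Nat.lt_succ_self _⟩ le_rfl)

theorem truncSigma_succ (w : Word d → E → Ω) (n : ℕ) (i : Word d) :
    truncSigma w (n + 1) i = ⨆ o, vertexSigma (w i) (fun j => truncSigma w n (i ++ [j])) o := by
  refine le_antisymm (iSup_le ?_) (iSup_le fun o => ?_)
  · rintro ⟨_ | ⟨a, j⟩, hj⟩
    · refine le_iSup_of_le none ?_
      simp
    · refine le_iSup_of_le (some a) ?_
      refine le_iSup_of_le (ι := Subtype _) ⟨j, by simpa using hj⟩ ?_
      simp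
  · cases o with
    | none =>
      refine le_iSup_of_le (ι := Subtype _) ⟨[], Nat.succ_pos n⟩ ?_
      simp
    | some a =>
      refine iSup_le fun j => ?_
      refine le_iSup_of_le (ι := Subtype _) ⟨a :: j.1, by simpa using j.2⟩ ?_
      simp

theorem subtreeSigma_eq (w : Word d → E → Ω) (i : Word d) :
    subtreeSigma w i = ⨆ o, vertexSigma (w i) (fun j => subtreeSigma w (i ++ [j])) o := by
  refine le_antisymm (iSup_le ?_) (iSup_le fun o => ?_)
  · rintro (_ | ⟨a, j⟩)
    · refine le_iSup_of_le none ?_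
      simp
    · refine le_iSup_of_le (some a) (le_iSup_of_le j ?_)
      simp
  · cases o with
    | none =>
      refine le_iSup_of_le [] ?_
      simp
    | some a =>
      refine iSup_le fun j => le_iSup_of_le (a :: j) ?_
      simp

theorem subtreeSigma_le [mE : MeasurableSpace E] {w : Word d → E → Ω} (hw : ∀ i, Measurable (w i))
    (i : Word d) : subtreeSigma w i ≤ mE :=
  iSup_le fun _ => (hw _).comap_le

theorem truncSigma_le_subtreeSigma (w : Word d → E → Ω) (n : ℕ) (i : Word d) :
    truncSigma w n i ≤ subtreeSigma w i :=
  iSup_le fun j => le_iSup_of_le j.1 le_rfl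

/-- The sigma-algebra carried by a word `k` when the tree is cut at level `N`: the randomness
`w k` below that level, and the value `X k` on it. -/
@[reducible]
def cutSigma (w : Word d → E → Ω) (X : Word d → E → S) (N : ℕ)
    (k : {k : Word d // k.length ≤ N}) : MeasurableSpace E :=
  if k.1.length < N then MeasurableSpace.comap (w k.1) inferInstance
  else MeasurableSpace.comap (X k.1) inferInstance

/-- The sigma-algebras attached at level `t` of the tree: that of the randomness below level `t`,
and for each word of length `t` that of its value and of the randomness in its subtree. -/
abbrev levelSigma (w : Word d → E → Ω) (X : Word d → E → S) (t : ℕ) :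
    Option {i : Word d // i.length = t} → MeasurableSpace E := fun o =>
  o.elim (⨆ k : {k : Word d // k.length < t}, MeasurableSpace.comap (w k.1) inferInstance)
    fun i => MeasurableSpace.comap (X i.1) inferInstance ⊔ subtreeSigma w i.1

/-- The words below level `t`, and those in the subtree of a given word of length `t`. -/
def levelBlock (d : ℕ∞) (t N : ℕ) (o : Option {i : Word d // i.length = t}) :
    Set {k : Word d // k.length ≤ N} :=
  o.elim {k | k.1.length < t} fun i => {k | i.1 <+: k.1}

theorem pairwise_disjoint_levelBlock (d : ℕ∞) (t N : ℕ) :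
    Pairwise fun a b => Disjoint (levelBlock d t N a) (levelBlock d t N b) := by
  have h : ∀ i : {i : Word d // i.length = t},
      Disjoint (levelBlock d t N none) (levelBlock d t N (some i)) := by
    refine fun i => Set.disjoint_left.2 fun k hk hik => ?_
    have h1 : k.1.length < t := hk
    have h2 := (show i.1 <+: k.1 from hik).length_le
    have h3 := i.2
    omega
  rintro (_ | i) (_ | j) hij
  · exact absurd rfl hij
  · exact h j
  · exact (h i).symm
  · refine Set.disjoint_left.2 fun k hik hjk => hij ?_
    have h1 : i.1 = k.1.take i.1.length := List.prefix_iff_eq_take.1 hik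
    have h2 : j.1 = k.1.take j.1.length := List.prefix_iff_eq_take.1 hjk
    rw [i.2] at h1
    rw [j.2] at h2
    exact congrArg some (Subtype.ext (h1.trans h2.symm))

/-- A `π`-system generating `levelSigma`; in the subtree of `i` only finitely many generations
are used by each of its members. -/
def levelPi (w : Word d → E → Ω) (X : Word d → E → S) (t : ℕ)
    (o : Option {i : Word d // i.length = t}) : Set (Set E) :=
  o.elim {s | MeasurableSet[levelSigma w X t none] s} fun i =>
    {s | ∃ A : Set S, MeasurableSet A ∧ ∃ n B, MeasurableSet[truncSigma w n i.1] B ∧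
      s = X i.1 ⁻¹' A ∩ B}

theorem isPiSystem_levelPi (w : Word d → E → Ω) (X : Word d → E → S) (t : ℕ)
    (o : Option {i : Word d // i.length = t}) : IsPiSystem (levelPi w X t o) := by
  cases o with
  | none => exact @MeasurableSpace.isPiSystem_measurableSet _ (levelSigma w X t none)
  | some i =>
    rintro _ ⟨A, hA, n, B, hB, rfl⟩ _ ⟨A', hA', n', B', hB', rfl⟩ -
    refine ⟨A ∩ A', hA.inter hA', max n n', B ∩ B', ?_, ?_⟩
    · exact MeasurableSet.inter (truncSigma_mono w i.1 (le_max_left n n') _ hB)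
        (truncSigma_mono w i.1 (le_max_right n n') _ hB')
    · rw [Set.preimage_inter, Set.inter_inter_inter_comm]

theorem generateFrom_levelPi (w : Word d → E → Ω) (X : Word d → E → S) (t : ℕ)
    (o : Option {i : Word d // i.length = t}) :
    levelSigma w X t o = MeasurableSpace.generateFrom (levelPi w X t o) := by
  cases o with
  | none => exact (@MeasurableSpace.generateFrom_measurableSet _ (levelSigma w X t none)).symm
  | some i =>
    refine le_antisymm (sup_le ?_ ?_) (MeasurableSpace.generateFrom_le ?_)
    · rintro _ ⟨A, hA, rfl⟩
      exact MeasurableSpace.measurableSet_generateFrom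
        ⟨A, hA, 0, Set.univ, MeasurableSet.univ, (Set.inter_univ _).symm⟩
    · rw [← iSup_truncSigma]
      refine iSup_le fun n B hB => ?_
      exact MeasurableSpace.measurableSet_generateFrom
        ⟨Set.univ, MeasurableSet.univ, n, B, hB, (Set.univ_inter _).symm⟩
    · rintro _ ⟨A, hA, n, B, hB, rfl⟩
      refine MeasurableSet.inter ?_ ?_
      · exact (le_sup_left : _ ≤ levelSigma w X t (some i)) _ ⟨A, hA, rfl⟩
      · exact ((truncSigma_le_subtreeSigma w n i.1).trans
          (le_sup_right : _ ≤ levelSigma w X t (some i))) _ hB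

theorem truncSigma_le_cutSigma (w : Word d → E → Ω) (X : Word d → E → S) {t m n : ℕ} (hmn : m ≤ n)
    (i : {i : Word d // i.length = t}) :
    truncSigma w m i.1 ≤ ⨆ k ∈ levelBlock d t (t + n) (some i), cutSigma w X (t + n) k := by
  refine iSup_le fun j => ?_
  have hlt : (i.1 ++ j.1).length < t + n := by
    have h1 := i.2
    have h2 := j.2
    rw [List.length_append]
    omega
  refine le_iSup₂_of_le (f := fun k _ => cutSigma w X (t + n) k) ⟨i.1 ++ j.1, hlt.le⟩
    (List.prefix_append _ _) ?_
  rw [cutSigma, if_pos hlt]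

end Tree

namespace IsRTP

variable {Ω S E : Type*} [MeasurableSpace Ω] [MeasurableSpace S] {d : ℕ∞}
  [mE : MeasurableSpace E] {P : Measure E} {G : RandomMap Ω S}
  {hκ : ∀ ω, G.κ ω ≤ d} {r : ProbabilityMeasure Ω} {μ : ProbabilityMeasure S}
  {w : Word d → E → Ω} {X : Word d → E → S}

theorem evalTree_ae_eq (hX : IsRTP G hκ r μ P w X) (n : ℕ) (i : Word d) :
    evalTree G hκ w X n i =ᵐ[P] X i := by
  induction n generalizing i with
  | zero => rfl
  | succ n ih =>
    filter_upwards [hX.recursion i, ae_all_iff.2 fun j => ih (i ++ [j])] with e he h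
    rw [he]
    exact congrArg (G.extend hκ (w i e)) (funext fun j => h j)

theorem cutSigma_le (hX : IsRTP G hκ r μ P w X) (N : ℕ) (k : {k : Word d // k.length ≤ N}) :
    cutSigma w X N k ≤ mE := by
  unfold cutSigma
  split_ifs
  · exact (hX.measurable_w k).comap_le
  · exact (hX.measurable_X k).comap_le

theorem iIndep_cutSigma (hX : IsRTP G hκ r μ P w X) {N : ℕ} (hN : 1 ≤ N) :
    iIndep (cutSigma w X N) P := by
  refine iIndep_of_split (fun k => k.1.length < N) ?_ ?_ ?_
  · refine iIndep_of_iIndep_of_le (iIndep.precomp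
      (g := fun k : {k : {k : Word d // k.length ≤ N} // k.1.length < N} => k.1.1)
      (Subtype.val_injective.comp Subtype.val_injective) hX.indep_w) fun k => ?_
    rw [cutSigma, if_pos k.2]
    exact le_rfl
  · refine iIndep_of_iIndep_of_le (iIndep.precomp
      (g := fun k : {k : {k : Word d // k.length ≤ N} // ¬ k.1.length < N} =>
        (⟨k.1.1, le_antisymm k.1.2 (not_lt.1 k.2)⟩ : {k : Word d // k.length = N}))
      (fun a b hab => Subtype.ext (Subtype.ext (Subtype.mk.inj hab)))
      (hX.indep_X N hN)) fun k => ?_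
    rw [cutSigma, if_neg k.2]
    exact le_rfl
  · refine indep_of_indep_of_le (hX.indep_X_w N hN).symm (iSup_le fun k => ?_)
      (iSup_le fun k => ?_)
    · rw [cutSigma, if_pos k.2]
      have h : w k.1.1 = (fun x : {i : Word d // i.length < N} → Ω => x ⟨k.1.1, k.2⟩) ∘
        fun e i => w i.1 e := rfl
      rw [h, ← MeasurableSpace.comap_comp]
      exact MeasurableSpace.comap_mono (measurable_pi_apply _).comap_le
    · have hk : k.1.1.length = N := le_antisymm k.1.2 (not_lt.1 k.2)
      rw [cutSigma, if_neg k.2]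
      have h : X k.1.1 = (fun x : {i : Word d // i.length = N} → S => x ⟨k.1.1, hk⟩) ∘
        fun e i => X i.1 e := rfl
      rw [h, ← MeasurableSpace.comap_comp]
      exact MeasurableSpace.comap_mono (measurable_pi_apply _).comap_le

/-- Up to null sets, the members of the generating `π`-system only depend on what the tree
carries when it is cut far enough: the value at a word of level `t` is replaced by the one
computed from the cut. -/
theorem exists_ae_eq_cut (hX : IsRTP G hκ r μ P w X) {t : ℕ}
    (o : Option {i : Word d // i.length = t}) {s : Set E} (hs : s ∈ levelPi w X t o) :
    ∃ m : ℕ, ∀ n, m ≤ n → ∃ s' : Set E, s =ᵐ[P] s' ∧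
      MeasurableSet[⨆ k ∈ levelBlock d t (t + n) o, cutSigma w X (t + n) k] s' := by
  cases o with
  | none =>
    refine ⟨1, fun n hn => ⟨s, Filter.EventuallyEq.rfl, ?_⟩⟩
    refine (iSup_le fun k => ?_ :
      (⨆ k : {k : Word d // k.length < t}, MeasurableSpace.comap (w k.1) inferInstance) ≤ _) _ hs
    have hlt : k.1.length < t + n := k.2.trans_le (Nat.le_add_right t n)
    refine le_iSup₂_of_le (f := fun k _ => cutSigma w X (t + n) k) ⟨k.1, hlt.le⟩ k.2 ?_
    rw [cutSigma, if_pos hlt]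
  | some i =>
    obtain ⟨A, hA, m, B, hB, rfl⟩ := hs
    refine ⟨m, fun n hn => ⟨evalTree G hκ w X n i.1 ⁻¹' A ∩ B, ?_, ?_⟩⟩
    · refine EventuallyEq.inter ?_ Filter.EventuallyEq.rfl
      filter_upwards [hX.evalTree_ae_eq n i.1] with e he
      exact congrArg A he.symm
    · refine MeasurableSet.inter ?_ (truncSigma_le_cutSigma w X hn i _ hB)
      refine measurable_evalTree (_) G hκ n i.1 (fun j hj => ?_) (fun j hj => ?_) hA
      · refine (comap_measurable (w (i.1 ++ j))).mono ?_ le_rfl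
        exact (le_iSup (fun j : {j : Word d // j.length < n} =>
          MeasurableSpace.comap (w (i.1 ++ j.1)) inferInstance) ⟨j, hj⟩).trans
          (truncSigma_le_cutSigma w X le_rfl i)
      · refine (comap_measurable (X (i.1 ++ j))).mono ?_ le_rfl
        have heq : (i.1 ++ j).length = t + n := by rw [List.length_append, i.2, hj]
        refine le_iSup₂_of_le (f := fun k _ => cutSigma w X (t + n) k) ⟨i.1 ++ j, heq.le⟩
          (List.prefix_append _ _) ?_
        rw [cutSigma, if_neg heq.not_lt]

/-- The randomness below level `t` and the pairs of value and subtree randomness at the words of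
length `t` are all independent. -/
theorem iIndep_levelSigma (hX : IsRTP G hκ r μ P w X) {t : ℕ} (ht : 1 ≤ t) :
    iIndep (levelSigma w X t) P := by
  classical
  have := hX.indep_w.isProbabilityMeasure
  refine iIndepSets.iIndep (fun o => ?_) _ (isPiSystem_levelPi w X t)
    (generateFrom_levelPi w X t) ((iIndepSets_iff _ _).2 fun s f hf => ?_)
  · cases o with
    | none => exact iSup_le fun k => (hX.measurable_w k.1).comap_le
    | some i => exact sup_le (hX.measurable_X i.1).comap_le (subtreeSigma_le hX.measurable_w i.1)
  have h : ∀ o, ∃ m : ℕ, o ∈ s → ∀ n, m ≤ n → ∃ s' : Set E, f o =ᵐ[P] s' ∧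
      MeasurableSet[⨆ k ∈ levelBlock d t (t + n) o, cutSigma w X (t + n) k] s' := fun o => by
    by_cases ho : o ∈ s
    · obtain ⟨m, hm⟩ := hX.exists_ae_eq_cut o (hf o ho)
      exact ⟨m, fun _ => hm⟩
    · exact ⟨0, fun h => absurd h ho⟩
  choose m hm using h
  have h' : ∀ o, ∃ s' : Set E, o ∈ s → f o =ᵐ[P] s' ∧
      MeasurableSet[⨆ k ∈ levelBlock d t (t + s.sup m) o, cutSigma w X (t + s.sup m) k] s' :=
    fun o => by
      by_cases ho : o ∈ s
      · obtain ⟨s', hs'⟩ := hm o ho (s.sup m) (Finset.le_sup ho)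
        exact ⟨s', fun _ => hs'⟩
      · exact ⟨∅, fun h => absurd h ho⟩
  choose f' hf' using h'
  have hind := iIndep_iSup_of_disjoint (hX.cutSigma_le (t + s.sup m))
    (hX.iIndep_cutSigma (ht.trans (Nat.le_add_right t (s.sup m))))
    (pairwise_disjoint_levelBlock d t (t + s.sup m))
  rw [measure_congr (s.eventuallyEq_iInter fun o ho => (hf' o ho).1),
    (iIndep_iff _ _).1 hind s fun o ho => (hf' o ho).2]
  exact Finset.prod_congr rfl fun o ho => (measure_congr (hf' o ho).1).symm

end IsRTP

/-! ### Processes adapted to a recursive tree process, and conditional laws -/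

namespace IsRTP

variable {Ω S E : Type*} [MeasurableSpace Ω] [MeasurableSpace S] {d : ℕ∞}
  [mE : MeasurableSpace E] {P : Measure E} {G : RandomMap Ω S}
  {hκ : ∀ ω, G.κ ω ≤ d} {r : ProbabilityMeasure Ω} {μ : ProbabilityMeasure S}
  {w : Word d → E → Ω} {X : Word d → E → S}

theorem iIndep_vertexSigma (hX : IsRTP G hκ r μ P w X) (i : Word d) :
    iIndep (vertexSigma (w i) fun j =>
      MeasurableSpace.comap (X (i ++ [j])) inferInstance ⊔ subtreeSigma w (i ++ [j])) P := by
  let f : Idx d → {k : Word d // k.length = i.length + 1} := fun j => ⟨i ++ [j], by simp⟩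
  have hf : Function.Injective f := fun a b hab => by
    have h : i ++ [a] = i ++ [b] := congrArg Subtype.val hab
    simpa using h
  refine iIndep_of_iIndep_of_le ((hX.iIndep_levelSigma (Nat.le_add_left 1 i.length)).precomp
    (Option.map_injective hf)) fun o => ?_
  cases o with
  | none => exact le_iSup_of_le (ι := Subtype _) ⟨i, Nat.lt_succ_self _⟩ le_rfl
  | some j => exact le_rfl

variable [IsProbabilityMeasure P]

/-- A process that at each vertex is a function of the value and of the randomness in the subtree
inherits the independence of a recursive tree process, so only its law and the recursion remain
to be checked. The solution equation follows from these two at a word of length one. -/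
theorem of_measurable (hX : IsRTP G hκ r μ P w X) (hd : 1 ≤ d) {S' : Type*} [MeasurableSpace S']
    {G' : RandomMap Ω S'} {hκ' : ∀ ω, G'.κ ω ≤ d} {ν : ProbabilityMeasure S'}
    {Y : Word d → E → S'}
    (hY : ∀ i, Measurable[MeasurableSpace.comap (X i) inferInstance ⊔ subtreeSigma w i] (Y i))
    (hlaw : ∀ i : Word d, 1 ≤ i.length → P.map (Y i) = (ν : Measure S'))
    (hrec : ∀ i, ∀ᵐ e ∂P, Y i e = G'.extend hκ' (w i e) fun j => Y (i ++ [j]) e) :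
    IsRTP G' hκ' r ν P w Y := by
  have hle : ∀ i, MeasurableSpace.comap (X i) inferInstance ⊔ subtreeSigma w i ≤ mE := fun i =>
    sup_le (hX.measurable_X i).comap_le (subtreeSigma_le hX.measurable_w i)
  have hlevel : ∀ t (o : Option {i : Word d // i.length = t}), levelSigma w X t o ≤ mE := by
    rintro t (_ | i)
    · exact iSup_le fun k => (hX.measurable_w k.1).comap_le
    · exact hle i.1
  refine ⟨Subtype.ext ?_, hX.measurable_w, fun i => (hY i).mono (hle i) le_rfl, hX.indep_w,
    hX.law_w, fun t ht => ?_, hlaw, fun t ht => ?_, hrec⟩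
  · let i : Word d := [⟨0, lt_of_lt_of_le (by simp) hd⟩]
    have h := map_extend_eq_T G' hκ' (hX.measurable_w i) (hX.law_w i) (fun j => hle (i ++ [j]))
      (hX.iIndep_vertexSigma i) (fun j => hY (i ++ [j])) (ν := ν)
      (fun j => hlaw _ (by simp))
    exact h.symm.trans ((Measure.map_congr (hrec i)).symm.trans (hlaw i le_rfl))
  · exact iIndep_of_iIndep_of_le ((hX.iIndep_levelSigma ht).precomp (Option.some_injective _))
      fun i => (hY i.1).comap_le
  · have h := indep_iSup_of_disjoint (hlevel t) (hX.iIndep_levelSigma ht)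
      (S := Set.range some) (T := {none}) (by simp)
    refine indep_of_indep_of_le h ?_ ?_
    · have hm : Measurable[⨆ o ∈ Set.range some, levelSigma w X t o]
          fun e (i : {i : Word d // i.length = t}) => Y i.1 e := by
        refine @measurable_pi_lambda _ _ _ (_) _ _ fun i => (hY i.1).mono ?_ le_rfl
        exact le_iSup₂_of_le (f := fun o _ => levelSigma w X t o) (some i) ⟨i, rfl⟩ le_rfl
      exact hm.comap_le
    · have hm : Measurable[levelSigma w X t none]
          fun e (k : {k : Word d // k.length < t}) => w k.1 e :=
        @measurable_pi_lambda _ _ _ (_) _ _ fun k => (comap_measurable (w k.1)).mono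
          (le_iSup (fun k : {k : Word d // k.length < t} =>
            MeasurableSpace.comap (w k.1) inferInstance) k) le_rfl
      exact hm.comap_le.trans
        (le_iSup₂_of_le (f := fun o _ => levelSigma w X t o) none rfl le_rfl)

/-- The recursion with constant boundary values `μ`, run for `n` steps with the maps `γ̌`, has
law `Ťⁿ(δ_μ)`. -/
theorem map_evalTree_check (hX : IsRTP G hκ r μ P w X) (n : ℕ) (i : Word d) :
    P.map (evalTree G.check hκ w (fun _ _ => μ) n i) =
      ((G.check.T r)^[n] (diracProba μ) : Measure (ProbabilityMeasure S)) := by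
  induction n generalizing i with
  | zero =>
    change P.map (fun _ => μ) = Measure.dirac μ
    simp
  | succ n ih =>
    rw [Function.iterate_succ_apply']
    refine map_extend_eq_T G.check hκ (hX.measurable_w i) (hX.law_w i)
      (F := fun j => truncSigma w n (i ++ [j]))
      (fun j => (truncSigma_le_subtreeSigma w n _).trans (subtreeSigma_le hX.measurable_w _))
      (iIndep_of_iIndep_of_le (hX.iIndep_vertexSigma i) fun o => ?_) (fun j => ?_)
      fun j => ih (i ++ [j])
    · cases o with
      | none => exact le_rfl
      | some j => exact (truncSigma_le_subtreeSigma w n _).trans le_sup_right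
    · refine measurable_evalTree _ _ _ n _ (fun k hk => ?_) fun k _ => measurable_const
      exact (comap_measurable (w (i ++ [j] ++ k))).mono
        (le_iSup (fun k : {k : Word d // k.length < n} =>
          MeasurableSpace.comap (w (i ++ [j] ++ k.1)) inferInstance) ⟨k, hk⟩) le_rfl

/-- `RecTree.isCondLaw_extend` at a vertex of a recursive tree process. -/
theorem isCondLaw_extend (hX : IsRTP G hκ r μ P w X) (i : Word d)
    {F : Idx d → MeasurableSpace E} (hF : ∀ j, F j ≤ subtreeSigma w (i ++ [j]))
    {ξ : Idx d → E → ProbabilityMeasure S}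
    (hξ : ∀ j, IsCondLaw P (F j) (X (i ++ [j])) (ξ j)) :
    IsCondLaw P (⨆ o, vertexSigma (w i) F o) (X i)
      (fun e => G.check.extend hκ (w i e) fun j => ξ j e) := by
  refine (RecTree.isCondLaw_extend G hκ (hX.measurable_w i)
    (fun j => (hF j).trans (subtreeSigma_le hX.measurable_w _)) rfl
    (fun j => hX.measurable_X (i ++ [j])) ?_ hξ).congr_ae ?_
  · refine iIndep_of_iIndep_of_le (hX.iIndep_vertexSigma i) fun o => ?_
    cases o with
    | none => exact le_rfl
    | some j => exact sup_le_sup_left (hF j) _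
  · filter_upwards [hX.recursion i] with e he
    exact he.symm

/-- The recursion with constant boundary values `μ`, run for `n` steps with the maps `γ̌`, is the
conditional law of the value given `n` generations of the subtree. The law of the value at the
root is only recovered after one step, whence the condition on `i` and `n`. -/
theorem isCondLaw_evalTree (hX : IsRTP G hκ r μ P w X) (n : ℕ) (i : Word d)
    (hi : 1 ≤ i.length + n) :
    IsCondLaw P (truncSigma w n i) (X i) (evalTree G.check hκ w (fun _ _ => μ) n i) := by
  induction n generalizing i with
  | zero =>
    have hbot : truncSigma w 0 i = ⊥ := by
      have : IsEmpty {j : Word d // j.length < 0} := ⟨fun j => Nat.not_lt_zero _ j.2⟩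
      exact iSup_of_empty _
    rw [hbot]
    refine (isCondLaw_iff bot_le (hX.measurable_X i)).2 ⟨measurable_const, fun A hA B hB => ?_⟩
    change P (B ∩ X i ⁻¹' A) = ∫⁻ e in B, (μ : Measure S) A ∂P
    rcases MeasurableSpace.measurableSet_bot_iff.1 hB with rfl | rfl
    · simp
    · rw [Set.univ_inter, ← Measure.map_apply (hX.measurable_X i) hA, hX.law_X i hi]
      simp
  | succ n ih =>
    rw [truncSigma_succ]
    exact hX.isCondLaw_extend i (fun j => truncSigma_le_subtreeSigma w n _)
      fun j => ih (i ++ [j]) (by rw [List.length_append, List.length_singleton]; omega)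

/-- The Dirac masses at the values form a recursive tree process. -/
theorem dirac (hX : IsRTP G hκ r μ P w X) (hd : 1 ≤ d) :
    IsRTP G.check hκ r (upper μ) P w (fun i e => diracProba (X i e)) := by
  refine hX.of_measurable hd (fun i => ?_) (fun i hi => ?_) fun i => ?_
  · exact measurable_diracProba.comp ((comap_measurable (X i)).mono le_sup_left le_rfl)
  · change _ = (μ : Measure S).map diracProba
    rw [← hX.law_X i hi, Measure.map_map measurable_diracProba (hX.measurable_X i)]
    rfl
  · filter_upwards [hX.recursion i] with e he
    rw [check_extend_diracProba]
    exact congrArg diracProba he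

variable [TopologicalSpace S] [PolishSpace S] [BorelSpace S]

/-- The law of the conditional law of `X i` given the subtree rooted at `i` is the weak limit of
`Ťⁿ(δ_μ)`: these are the laws of the conditional laws given `n` generations of the subtree. -/
theorem isLowerLimit_map (hX : IsRTP G hκ r μ P w X) {i : Word d} (hi : 1 ≤ i.length)
    {ξ : E → ProbabilityMeasure S} (hξ : IsCondLaw P (subtreeSigma w i) (X i) ξ)
    {ρ : ProbabilityMeasure (ProbabilityMeasure S)}
    (hρ : P.map ξ = (ρ : Measure (ProbabilityMeasure S))) : IsLowerLimit G r μ ρ := by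
  have hle := subtreeSigma_le hX.measurable_w i
  let 𝓕 : Filtration ℕ mE := ⟨fun n => truncSigma w n i, truncSigma_mono w i,
    fun n => (truncSigma_le_subtreeSigma w n i).trans hle⟩
  have hη := fun n => hX.isCondLaw_evalTree n i (le_add_right hi)
  have hlim := ae_tendsto_of_isCondLaw 𝓕 hη (ξ := ξ) (by
    have h : ⨆ n, 𝓕 n = subtreeSigma w i := iSup_truncSigma w i
    rw [h]
    exact hξ)
  refine ProbabilityMeasure.tendsto_iff_forall_integral_tendsto.2 fun f => ?_
  have hf := f.continuous.measurable
  have hηm := fun n => (hη n).measurable.mono (𝓕.le n) le_rfl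
  have hξm := hξ.measurable.mono hle le_rfl
  rw [← hρ, integral_map hξm.aemeasurable hf.aestronglyMeasurable]
  simp_rw [← hX.map_evalTree_check _ i]
  have hint : ∀ n, ∫ x, f x ∂(P.map (evalTree G.check hκ w (fun _ _ => μ) n i)) =
      ∫ e, f (evalTree G.check hκ w (fun _ _ => μ) n i e) ∂P := fun n =>
    integral_map (hηm n).aemeasurable hf.aestronglyMeasurable
  simp_rw [hint]
  refine tendsto_integral_of_dominated_convergence (fun _ => ‖f‖)
    (fun n => (hf.comp (hηm n)).aestronglyMeasurable) (integrable_const _)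
    (fun n => Eventually.of_forall fun e => f.norm_coe_le_norm _) ?_
  filter_upwards [hlim] with e he
  exact (f.continuous.tendsto _).comp he

/-- The conditional laws given the subtrees form a recursive tree process. -/
theorem condLaw (hX : IsRTP G hκ r μ P w X) (hd : 1 ≤ d)
    {ρ : ProbabilityMeasure (ProbabilityMeasure S)} (hρ : IsLowerLimit G r μ ρ)
    {ξ : Word d → E → ProbabilityMeasure S}
    (hξ : ∀ i, IsCondLaw P (subtreeSigma w i) (X i) (ξ i)) :
    IsRTP G.check hκ r ρ P w ξ := by
  have hle := subtreeSigma_le hX.measurable_w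
  refine hX.of_measurable hd (fun i => (hξ i).measurable.mono le_sup_right le_rfl)
    (fun i hi => ?_) fun i => ?_
  · let ρ' : ProbabilityMeasure (ProbabilityMeasure S) := ⟨P.map (ξ i),
      Measure.isProbabilityMeasure_map ((hξ i).measurable.mono (hle i) le_rfl).aemeasurable⟩
    have h : IsLowerLimit G r μ ρ' := hX.isLowerLimit_map hi (hξ i) rfl
    exact congrArg (fun ν : ProbabilityMeasure (ProbabilityMeasure S) =>
      (ν : Measure (ProbabilityMeasure S))) (tendsto_nhds_unique h hρ)
  · have h := hX.isCondLaw_extend i (fun _ => le_rfl) fun j => hξ (i ++ [j])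
    rw [← subtreeSigma_eq] at h
    exact (hξ i).ae_unique (hle i) h

end IsRTP

end RecTree

theorem mainTheorem4
    {Ω S E : Type*}
    [TopologicalSpace Ω] [PolishSpace Ω] [MeasurableSpace Ω] [BorelSpace Ω]
    [TopologicalSpace S] [PolishSpace S] [MeasurableSpace S] [BorelSpace S]
    [MeasurableSpace E] (P : Measure E) [IsProbabilityMeasure P]
    (d : ℕ∞) (hd : 1 ≤ d) (G : RecTree.RandomMap Ω S) (hκ : ∀ ω, G.κ ω ≤ d)
    (r : ProbabilityMeasure Ω) (μ : ProbabilityMeasure S)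
    (w : RecTree.Word d → E → Ω) (X : RecTree.Word d → E → S)
    (hX : RecTree.IsRTP G hκ r μ P w X) :
    (∃ μlow : ProbabilityMeasure (ProbabilityMeasure S),
      (∀ ρ, RecTree.IsLowerLimit G r μ ρ ↔ ρ = μlow) ∧
      ∀ ξ : RecTree.Word d → E → ProbabilityMeasure S,
        (∀ i, RecTree.IsCondLaw P (RecTree.subtreeSigma w i) (X i) (ξ i)) →
        RecTree.IsRTP G.check hκ r μlow P w ξ) ∧
    RecTree.IsRTP G.check hκ r (RecTree.upper μ) P w (fun i e => diracProba (X i e)) := by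
  let i : RecTree.Word d := [⟨0, lt_of_lt_of_le (by simp) hd⟩]
  obtain ⟨ξ, hξ⟩ := RecTree.exists_isCondLaw P hX.measurable_w (hX.measurable_X i) i
  have hξm := hξ.measurable.mono (RecTree.subtreeSigma_le hX.measurable_w i) le_rfl
  let ρ : ProbabilityMeasure (ProbabilityMeasure S) :=
    ⟨P.map ξ, Measure.isProbabilityMeasure_map hξm.aemeasurable⟩
  have hρ : RecTree.IsLowerLimit G r μ ρ := hX.isLowerLimit_map le_rfl hξ rfl
  refine ⟨⟨ρ, fun ρ' => ⟨fun h => tendsto_nhds_unique h hρ, fun h => h ▸ hρ⟩, fun ξ' hξ' =>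
    hX.condLaw hd hρ hξ'⟩, hX.dirac hd⟩
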